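/- Fix a nonempty set $\Sigma$ of labels. A \emph{weak transition system} $X$ consists of a set $S$ of states, a set $L$ of actions, a labelling map $\mu:L\to\Sigma$, and for each $n\ge 1$ a set of $n$-transitions $(\alpha,u_1,\dots,u_n,\beta)\in S\times L^n\times S$, such that (Multiset axiom) the transitions are stable under permutation of $u_1,\dots,u_n$, and (Composition axiom) for $n\ge 3$ and $p,q\ge 1$ with $p+q<n$, if $(\alpha,u_1,\dots,u_n,\beta)$, $(\alpha,u_1,\dots,u_p,\nu_1)$, $(\nu_1,u_{p+1},\dots,u_n,\beta)$, $(\alpha,u_1,\dots,u_{p+q},\nu_2)$ and $(\nu_2,u_{p+q+1},\dots,u_n,\beta)$ are transitions, then so is $(\nu_1,u_{p+1},\dots,u_{p+q},\nu_2)$. A map of weak transition systems is a pair of maps, on states and on actions, preserving labels and transitions. Such an $X$ is \emph{cubical} if every action $u$ occurs in some $1$-transition $(\alpha,u,\beta)$ and if for every transition $(\alpha,u_1,\dots,u_n,\beta)$ with $n\ge 2$ and every $1\le p<n$ there is a state $\nu$ such that $(\alpha,u_1,\dots,u_p,\nu)$ and $(\nu,u_{p+1},\dots,u_n,\beta)$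 are transitions; it is \emph{regular} if moreover this $\nu$ is always unique. Let $\mathcal{CTS}$ and $\mathcal{RTS}$ be the full subcategories of cubical and of regular transition systems. For $x\in\Sigma$, let $C_1[x]$ have two states $0,1$, one action labelled by $x$, and one transition, from $0$ to $1$. Let $p_x$ be the map with source $C_1[x]\sqcup C_1[x]$ which is bijective on states and identifies the two actions; its target has four states, one action labelled by $x$, and exactly two transitions, the images of those of the source. Let $\mathcal S=\{p_x\mid x\in\Sigma\}$. An object $Z$ is \emph{$\mathcal S$-injective} if for each $x$ every map $C_1[x]\sqcup C_1[x]\to Z$ factors through $p_x$. The full subcategories of $\mathcal S$-injective objects of $\mathcal{CTS}$ and of $\mathcal{RTS}$ are reflective; let $L^{\mathcal{CTS}}_{\mathcal S}$ and $L^{\mathcal{RTS}}_{\mathcal S}$ be the reflections, i.e. the left adjoints of the inclusions, and consider the unit maps $X\to L^{\mathcal{CTS}}_{\mathcal S}(X)$ and $Y\to L^{\mathcal{RTS}}_{\mathcal S}(Y)$. A map is \emph{onto on transitions} if every transition of its target is the image of a transition of its source. \textbf{Proposition.} (1) For every cubical transition system $X$, the map $X\to L^{\mathcal{CTS}}_{\mathcal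 S}(X)$ is bijective on states and onto on actions. (2) There exists a cubical transition system $X_0$ such that $X_0\to L^{\mathcal{CTS}}_{\mathcal S}(X_0)$ is not onto on transitions. (3) For every regular transition system $Y$, the map $Y\to L^{\mathcal{RTS}}_{\mathcal S}(Y)$ is onto on states, on actions and on transitions. (4) There exists a regular transition system $Y_0$ such that $Y_0\to L^{\mathcal{RTS}}_{\mathcal S}(Y_0)$ is not bijective on states. -/

import Mathlib

open CategoryTheory

universe u

/-- A weak (higher dimensional) transition system over the set of labels `Lab`: states, actions,
a labelling map, and a set of transitions.  `Tr α [u₁, …, uₙ] β` says that the tuple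
`(α, u₁, …, uₙ, β)` is an `n`-transition; there are `n`-transitions for `n ≥ 1` only. -/
structure WTS (Lab : Type u) where
  /-- The set of states. -/
  State : Type u
  /-- The set of actions. -/
  Act : Type u
  /-- The labelling map. -/
  lab : Act → Lab
  /-- The transitions. -/
  Tr : State → List Act → State → Prop
  ne_nil : ∀ {α β : State} {l : List Act}, Tr α l β → l ≠ []
  /-- The Multiset axiom. -/
  multiset : ∀ {α β : State} {l l' : List Act}, l.Perm l' → Tr α l β → Tr α l' β
  /-- The Composition axiom. -/
  composition : ∀ {α β ν₁ ν₂ : State} {a b c : List Act}, a ≠ [] → b ≠ [] → c ≠ [] →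
    Tr α (a ++ b ++ c) β → Tr α a ν₁ → Tr ν₁ (b ++ c) β → Tr α (a ++ b) ν₂ → Tr ν₂ c β →
    Tr ν₁ b ν₂

namespace WTS

variable {Lab : Type u}

/-- A map of weak transition systems. -/
@[ext]
structure Hom (X Y : WTS Lab) where
  /-- The map on states. -/
  onState : X.State → Y.State
  /-- The map on actions. -/
  onAct : X.Act → Y.Act
  lab_onAct : ∀ u, Y.lab (onAct u) = X.lab u
  map_tr : ∀ {α β : X.State} {l : List X.Act}, X.Tr α l β →
    Y.Tr (onState α) (l.map onAct) (onState β)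

/-- The category of weak transition systems. -/
instance : Category (WTS Lab) where
  Hom := Hom
  id X := ⟨id, id, fun _ => rfl, fun h => by simpa using h⟩
  comp f g := ⟨g.onState ∘ f.onState, g.onAct ∘ f.onAct,
    fun u => (g.lab_onAct _).trans (f.lab_onAct u),
    fun h => by simpa using g.map_tr (f.map_tr h)⟩

/-- All actions are used. -/
def AllActionsUsed (X : WTS Lab) : Prop :=
  ∀ u : X.Act, ∃ α β : X.State, X.Tr α [u] β

/-- The Intermediate state axiom. -/
def IntermediateState (X : WTS Lab) : Prop :=
  ∀ (α β : X.State) (a b : List X.Act), a ≠ [] → b ≠ [] → X.Tr α (a ++ b) β →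
    ∃ ν, X.Tr α a ν ∧ X.Tr ν b β

/-- The Unique intermediate state axiom (CSA2). -/
def UniqueIntermediateState (X : WTS Lab) : Prop :=
  ∀ (α β : X.State) (a b : List X.Act), a ≠ [] → b ≠ [] → X.Tr α (a ++ b) β →
    ∃! ν, X.Tr α a ν ∧ X.Tr ν b β

/-- Cubical transition systems. -/
def isCubical (Lab : Type u) : ObjectProperty (WTS Lab) :=
  fun X => X.AllActionsUsed ∧ X.IntermediateState

/-- Regular transition systems. -/
def isRegular (Lab : Type u) : ObjectProperty (WTS Lab) :=
  fun X => X.AllActionsUsed ∧ X.UniqueIntermediateState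

/-- A weak transition system all of whose transitions are `1`-transitions. -/
def ofEdges {S L : Type u} (lab : L → Lab) (E : S → L → S → Prop) : WTS Lab where
  State := S
  Act := L
  lab := lab
  Tr α l β := ∃ u, l = [u] ∧ E α u β
  ne_nil := by
    rintro _ _ _ ⟨u, rfl, -⟩
    simp
  multiset := by
    rintro _ _ _ _ hp ⟨u, rfl, h⟩
    exact ⟨u, List.perm_singleton.1 hp.symm, h⟩
  composition := by
    rintro _ _ _ _ a b c ha hb hc ⟨u, h, -⟩
    rcases List.append_eq_singleton_iff.1 h with ⟨h, -⟩ | ⟨-, h⟩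
    exacts [absurd (List.append_eq_nil_iff.1 h).1 ha, absurd h hc]

theorem ofEdges_isRegular {S L : Type u} (lab : L → Lab) (E : S → L → S → Prop)
    (hE : ∀ u, ∃ α β, E α u β) : isRegular Lab (ofEdges lab E) := by
  refine ⟨fun u => ?_, ?_⟩
  · obtain ⟨α, β, h⟩ := hE u
    exact ⟨α, β, u, rfl, h⟩
  · rintro _ _ a b ha hb ⟨u, h, -⟩
    rcases List.append_eq_singleton_iff.1 h with ⟨h, -⟩ | ⟨-, h⟩
    exacts [absurd h ha, absurd h hb]

/-- The disjoint union `C₁[x] ⊔ C₁[x]` of two copies of the `1`-cube labelled by `x`.  The copy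
`i` has the two states `(i, false)` and `(i, true)`, its own action `i` labelled by `x`, and the
transition `((i, false), i, (i, true))`. -/
def edgePair (x : Lab) : WTS Lab :=
  ofEdges (S := ULift.{u} (Bool × Bool)) (L := ULift.{u} Bool) (fun _ => x)
    (fun α i β => α = ⟨(i.down, false)⟩ ∧ β = ⟨(i.down, true)⟩)

/-- The double transition labelled by `x`: the four states of `edgePair x`, one action labelled
by `x`, and two transitions, from `(i, false)` to `(i, true)` for each `i`. -/
def doubleTransition (x : Lab) : WTS Lab :=
  ofEdges (S := ULift.{u} (Bool × Bool)) (L := PUnit.{u + 1}) (fun _ => x)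
    (fun α _ β => ∃ i : Bool, α = ⟨(i, false)⟩ ∧ β = ⟨(i, true)⟩)

/-- The map `p_x : C₁[x] ⊔ C₁[x] ⟶` (double transition labelled by `x`), the identity on states,
which identifies the two actions. -/
def p (x : Lab) : edgePair x ⟶ doubleTransition x :=
  Hom.mk (X := edgePair x) (Y := doubleTransition x) (fun α => α) (fun _ => PUnit.unit)
    (fun _ => rfl) (by
      rintro α β l ⟨i, rfl, h⟩
      exact ⟨PUnit.unit, rfl, i.down, h⟩)

theorem edgePair_isRegular (x : Lab) : isRegular Lab (edgePair x) :=
  ofEdges_isRegular _ _ fun _ => ⟨_, _, rfl, rfl⟩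

theorem doubleTransition_isRegular (x : Lab) : isRegular Lab (doubleTransition x) :=
  ofEdges_isRegular _ _ fun _ => ⟨_, _, false, rfl, rfl⟩

theorem isRegular_le_isCubical : isRegular Lab ≤ isCubical Lab :=
  fun _ h => ⟨h.1, fun α β a b ha hb ht => (h.2 α β a b ha hb ht).exists⟩

end WTS

/-- The category of cubical transition systems. -/
abbrev CTS (Lab : Type u) := (WTS.isCubical Lab).FullSubcategory

/-- The category of regular transition systems. -/
abbrev RTS (Lab : Type u) := (WTS.isRegular Lab).FullSubcategory

/-- The map `p_x` in the category of cubical transition systems. -/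
def pCTS {Lab : Type u} (x : Lab) :
    (⟨WTS.edgePair x, WTS.isRegular_le_isCubical _ (WTS.edgePair_isRegular x)⟩ : CTS Lab) ⟶
      ⟨WTS.doubleTransition x,
        WTS.isRegular_le_isCubical _ (WTS.doubleTransition_isRegular x)⟩ :=
  ObjectProperty.homMk (WTS.p x)

/-- The map `p_x` in the category of regular transition systems. -/
def pRTS {Lab : Type u} (x : Lab) :
    (⟨WTS.edgePair x, WTS.edgePair_isRegular x⟩ : RTS Lab) ⟶
      ⟨WTS.doubleTransition x, WTS.doubleTransition_isRegular x⟩ :=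
  ObjectProperty.homMk (WTS.p x)

/-- The object `Z` is injective with respect to the map `i`. -/
def InjectiveWrt {C : Type*} [Category C] {A B : C} (i : A ⟶ B) (Z : C) : Prop :=
  ∀ φ : A ⟶ Z, ∃ ℓ : B ⟶ Z, i ≫ ℓ = φ

/-- The `S`-injective cubical transition systems, where `S = {p_x | x ∈ Lab}`. -/
def sInjCTS (Lab : Type u) : ObjectProperty (CTS Lab) :=
  fun Z => ∀ x : Lab, InjectiveWrt (pCTS x) Z

/-- The `S`-injective regular transition systems, where `S = {p_x | x ∈ Lab}`. -/
def sInjRTS (Lab : Type u) : ObjectProperty (RTS Lab) :=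
  fun Z => ∀ x : Lab, InjectiveWrt (pRTS x) Z

/-! ### Existence of the reflections -/

namespace WTS

variable {Lab : Type u}

theorem isRightAdjoint_of_reflections {C : Type*} [Category C] (P : ObjectProperty C)
    (h : ∀ X : C, ∃ (Z : C) (_ : P Z) (η : X ⟶ Z), ∀ Y : C, P Y → ∀ f : X ⟶ Y,
      ∃! g : Z ⟶ Y, η ≫ g = f) : P.ι.IsRightAdjoint := by
  choose Z hZ η hη using h
  refine ⟨_, ⟨Adjunction.adjunctionOfEquivLeft (G := P.ι) (F_obj := fun X => ⟨Z X, hZ X⟩)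
    (fun X Y => Equiv.ofBijective (fun g => η X ≫ g.hom) ⟨?_, ?_⟩) ?_⟩⟩
  · intro g g' hg
    ext
    exact (hη X Y.obj Y.property (η X ≫ g.hom)).unique rfl hg.symm
  · intro f
    obtain ⟨g, hg, -⟩ := hη X Y.obj Y.property f
    exact ⟨ObjectProperty.homMk g, hg⟩
  · intro X Y Y' g k
    exact (Category.assoc _ _ _).symm

/-- An extension along `p_x` forces actions with the same label to be equal. -/
theorem lab_injective (Z : WTS Lab) (hu : Z.AllActionsUsed)
    (h : ∀ x : Lab, InjectiveWrt (p x) Z) : Function.Injective Z.lab := by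
  intro u v huv
  obtain ⟨α, β, hα⟩ := hu u
  obtain ⟨γ, δ, hγ⟩ := hu v
  let φ : edgePair (Z.lab u) ⟶ Z := Hom.mk (X := edgePair (Z.lab u))
    (fun s => match s.down with
      | (false, false) => α | (false, true) => β | (true, false) => γ | (true, true) => δ)
    (fun i => match i.down with | false => u | true => v)
    (by rintro ⟨_ | _⟩ <;> simp [edgePair, ofEdges, huv])
    (by rintro _ _ _ ⟨⟨_ | _⟩, rfl, rfl, rfl⟩ <;> simpa)
  obtain ⟨l, hl⟩ := h _ φ
  have h1 : l.onAct PUnit.unit = u := congrFun (congrArg Hom.onAct hl) ⟨false⟩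
  have h2 : l.onAct PUnit.unit = v := congrFun (congrArg Hom.onAct hl) ⟨true⟩
  exact h1.symm.trans h2

theorem injectiveWrt_p (Z : WTS Lab) (h : Function.Injective Z.lab) (x : Lab) :
    InjectiveWrt (p x) Z := by
  intro φ
  have hφ : ∀ i, φ.onAct i = φ.onAct ⟨false⟩ := fun i =>
    h ((φ.lab_onAct i).trans (φ.lab_onAct (⟨false⟩ : ULift Bool)).symm)
  refine ⟨Hom.mk (X := doubleTransition x) φ.onState (fun _ => φ.onAct ⟨false⟩)
    (fun _ => φ.lab_onAct _) ?_, ?_⟩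
  · rintro α β l ⟨_, rfl, i, hα, hβ⟩
    have := φ.map_tr (α := α) (β := β) (l := [⟨i⟩]) ⟨⟨i⟩, rfl, hα, hβ⟩
    change Z.Tr _ [φ.onAct (⟨i⟩ : ULift Bool)] _ at this
    rw [hφ ⟨i⟩] at this
    exact this
  · exact Hom.ext rfl (funext fun i => (hφ i).symm)

theorem sInjCTS_iff (Z : CTS Lab) : sInjCTS Lab Z ↔ Function.Injective Z.obj.lab := by
  constructor
  · intro h
    refine lab_injective _ Z.property.1 fun x φ => ?_
    obtain ⟨l, hl⟩ := h x (ObjectProperty.homMk φ)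
    exact ⟨l.hom, congrArg (fun k => k.hom) hl⟩
  · intro h x φ
    obtain ⟨l, hl⟩ := injectiveWrt_p _ h x φ.hom
    exact ⟨ObjectProperty.homMk l, ObjectProperty.hom_ext _ hl⟩

theorem sInjRTS_iff (Z : RTS Lab) : sInjRTS Lab Z ↔ Function.Injective Z.obj.lab := by
  constructor
  · intro h
    refine lab_injective _ Z.property.1 fun x φ => ?_
    obtain ⟨l, hl⟩ := h x (ObjectProperty.homMk φ)
    exact ⟨l.hom, congrArg (fun k => k.hom) hl⟩
  · intro h x φ
    obtain ⟨l, hl⟩ := injectiveWrt_p _ h x φ.hom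
    exact ⟨ObjectProperty.homMk l, ObjectProperty.hom_ext _ hl⟩

theorem perm_of_map_perm {A B : Type*} (f : A → B) {l : List A} {l' : List B}
    (h : (l.map f).Perm l') : ∃ k, l.Perm k ∧ k.map f = l' := by
  have h2 := h.symm
  rw [← congrFun (congrFun (List.eq_map_comp_perm f) l') l] at h2
  obtain ⟨k, hk, hp⟩ := h2
  exact ⟨k, hp.symm, hk.symm⟩

/-- The transitions obtained by identifying the actions of `X` with their labels and closing under
the Composition axiom. -/
inductive LabTr (X : WTS Lab) : X.State → List (Set.range X.lab) → X.State → Prop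
  | base {α β : X.State} {l : List X.Act} : X.Tr α l β →
      LabTr X α (l.map (Set.rangeFactorization X.lab)) β
  | comp {α β ν₁ ν₂ : X.State} {a b c : List (Set.range X.lab)} : a ≠ [] → b ≠ [] → c ≠ [] →
      LabTr X α (a ++ b ++ c) β → LabTr X α a ν₁ → LabTr X ν₁ (b ++ c) β →
      LabTr X α (a ++ b) ν₂ → LabTr X ν₂ c β → LabTr X ν₁ b ν₂

theorem LabTr.perm {X : WTS Lab} {α β : X.State} {l : List (Set.range X.lab)}
    (h : LabTr X α l β) : ∀ {l'}, l.Perm l' → LabTr X α l' β := by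
  induction h with
  | base h =>
    intro l' hp
    obtain ⟨k, hk, rfl⟩ := perm_of_map_perm _ hp
    exact .base (X.multiset hk h)
  | comp ha hb hc _ h2 _ _ h5 ih1 _ ih3 ih4 _ =>
    intro l' hp
    have hl' : l' ≠ [] := fun h => hb (List.Perm.eq_nil (h ▸ hp))
    exact .comp ha hl' hc (ih1 ((hp.append_left _).append_right _)) h2 (ih3 (hp.append_right _))
      (ih4 (hp.append_left _)) h5

theorem LabTr.intermediate {X : WTS Lab} (hX : X.IntermediateState) {α β : X.State}
    {l : List (Set.range X.lab)} (h : LabTr X α l β) : ∀ {a b}, a ≠ [] → b ≠ [] → l = a ++ b →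
      ∃ ν, LabTr X α a ν ∧ LabTr X ν b β := by
  induction h with
  | base h =>
    intro a b ha hb hl
    obtain ⟨a, b, rfl, rfl, rfl⟩ := List.map_eq_append_iff.1 hl
    obtain ⟨ν, h1, h2⟩ := hX _ _ a b (by simpa using ha) (by simpa using hb) h
    exact ⟨ν, .base h1, .base h2⟩
  | @comp α β ν₁ ν₂ a b c ha hb hc h1 h2 h3 h4 h5 ih1 _ _ _ _ =>
    rintro b₁ b₂ hb₁ hb₂ rfl
    obtain ⟨ν, k1, k2⟩ := ih1 (a := a ++ b₁) (b := b₂ ++ c) (by simp [ha]) (by simp [hc])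
      (by simp)
    refine ⟨ν, ?_, ?_⟩
    · exact .comp (c := b₂ ++ c) ha hb₁ (by simp [hc]) (by simpa using h1) h2
        (by simpa using h3) k1 k2
    · exact .comp (a := a ++ b₁) (b := b₂) (c := c) (by simp [ha]) hb₂ hc (by simpa using h1) k1 k2
        (by simpa using h4) h5

/-- The labelling of `X` made one-to-one, without identifying states. -/
def labQuot (X : WTS Lab) : WTS Lab where
  State := X.State
  Act := Set.range X.lab
  lab := Subtype.val
  Tr := LabTr X
  ne_nil h := by
    cases h with
    | base h => simpa using X.ne_nil h
    | comp _ hb => exact hb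
  multiset hp h := h.perm hp
  composition := .comp

/-- The action part of the factorization of `f` through the identification of actions having the
same label. -/
noncomputable def descAct {X Y : WTS Lab} (f : X ⟶ Y) (r : Set.range X.lab) : Y.Act :=
  f.onAct r.2.choose

theorem lab_descAct {X Y : WTS Lab} (f : X ⟶ Y) (r : Set.range X.lab) :
    Y.lab (descAct f r) = r.1 :=
  (f.lab_onAct _).trans r.2.choose_spec

theorem descAct_comp {X Y : WTS Lab} (hY : Function.Injective Y.lab) (f : X ⟶ Y) :
    descAct f ∘ Set.rangeFactorization X.lab = f.onAct :=
  funext fun u => hY ((lab_descAct f _).trans (f.lab_onAct u).symm)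

theorem LabTr.map {X Y : WTS Lab} (hY : Function.Injective Y.lab) (f : X ⟶ Y)
    {α l β} (h : LabTr X α l β) :
    Y.Tr (f.onState α) (l.map (descAct f)) (f.onState β) := by
  induction h with
  | base h =>
    rw [List.map_map, descAct_comp hY]
    exact f.map_tr h
  | comp ha hb hc _ _ _ _ _ h1 h2 h3 h4 h5 =>
    refine Y.composition (by simpa using ha) (by simpa using hb) (by simpa using hc)
      ?_ h2 ?_ ?_ h5
    · simpa using h1
    · simpa using h3
    · simpa using h4

theorem isRightAdjoint_sInjCTS : (sInjCTS Lab).ι.IsRightAdjoint := by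
  refine isRightAdjoint_of_reflections _ fun X => ?_
  have hQ : isCubical Lab (labQuot X.obj) := by
    refine ⟨?_, fun α β a b ha hb h => LabTr.intermediate X.property.2 h ha hb rfl⟩
    rintro ⟨_, u, rfl⟩
    obtain ⟨α, β, h⟩ := X.property.1 u
    exact ⟨α, β, .base h⟩
  let η : X.obj ⟶ labQuot X.obj := Hom.mk (Y := labQuot X.obj) id (Set.rangeFactorization _)
    (fun _ => rfl) .base
  refine ⟨⟨_, hQ⟩, (sInjCTS_iff _).2 Subtype.val_injective, ObjectProperty.homMk η,
    fun Y hY f => ?_⟩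
  rw [sInjCTS_iff] at hY
  let g : labQuot X.obj ⟶ Y.obj := Hom.mk (X := labQuot X.obj) f.hom.onState (descAct f.hom)
    (lab_descAct f.hom) (fun h => LabTr.map hY f.hom h)
  refine ⟨ObjectProperty.homMk g, ?_, ?_⟩
  · exact ObjectProperty.hom_ext _ (Hom.ext rfl (descAct_comp hY f.hom))
  · intro k hk
    refine ObjectProperty.hom_ext _ (Hom.ext ?_ (funext fun r => hY ?_))
    · exact congrArg (fun k => k.hom.onState) hk
    · exact (k.hom.lab_onAct r).trans (lab_descAct f.hom r).symm

/-- Two states of `X` are identified if all maps to regular transition systems with a one-to-one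
labelling map identify them. -/
def stateSetoid (X : WTS Lab) : Setoid X.State where
  r s t := ∀ Y : WTS Lab, isRegular Lab Y → Function.Injective Y.lab → ∀ f : X ⟶ Y,
    f.onState s = f.onState t
  iseqv := ⟨fun _ _ _ _ _ => rfl, fun h Y h1 h2 f => (h Y h1 h2 f).symm,
    fun h k Y h1 h2 f => (h Y h1 h2 f).trans (k Y h1 h2 f)⟩

/-- The state part of the factorization of `f` through the quotient by `stateSetoid`. -/
def descState {X Y : WTS Lab} (hY : isRegular Lab Y) (hl : Function.Injective Y.lab)
    (f : X ⟶ Y) : Quotient (stateSetoid X) → Y.State :=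
  Quotient.lift f.onState fun _ _ h => h Y hY hl f

/-- The image of the transitions of `X` in the quotient by `stateSetoid` and by labels. -/
def RegTr (X : WTS Lab) (α : Quotient (stateSetoid X)) (l : List (Set.range X.lab))
    (β : Quotient (stateSetoid X)) : Prop :=
  ∃ α' l' β', X.Tr α' l' β' ∧ Quotient.mk _ α' = α ∧
    l'.map (Set.rangeFactorization X.lab) = l ∧ Quotient.mk _ β' = β

theorem RegTr.map {X Y : WTS Lab} (hY : isRegular Lab Y) (hl : Function.Injective Y.lab)
    (f : X ⟶ Y) {α l β} (h : RegTr X α l β) :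
    Y.Tr (descState hY hl f α) (l.map (descAct f)) (descState hY hl f β) := by
  obtain ⟨α, l, β, h, rfl, rfl, rfl⟩ := h
  rw [List.map_map, descAct_comp hl]
  exact f.map_tr h

theorem RegTr.state_eq {X : WTS Lab} {α β ν ν' : Quotient (stateSetoid X)}
    {a b : List (Set.range X.lab)} (h : RegTr X α (a ++ b) β) (h1 : RegTr X α a ν)
    (h2 : RegTr X ν b β) (h1' : RegTr X α a ν') (h2' : RegTr X ν' b β) : ν = ν' := by
  have ha : a ≠ [] := by
    obtain ⟨_, _, _, h1, _, rfl, _⟩ := h1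
    simpa using X.ne_nil h1
  have hb : b ≠ [] := by
    obtain ⟨_, _, _, h2, _, rfl, _⟩ := h2
    simpa using X.ne_nil h2
  induction ν using Quotient.inductionOn with | _ s =>
  induction ν' using Quotient.inductionOn with | _ t =>
  refine Quotient.sound fun Y hY hl f => ?_
  have key := h.map hY hl f
  rw [List.map_append] at key
  exact (hY.2 _ _ _ _ (by simpa using ha) (by simpa using hb) key).unique
    ⟨h1.map hY hl f, h2.map hY hl f⟩ ⟨h1'.map hY hl f, h2'.map hY hl f⟩

/-- The quotient of a regular transition system by `stateSetoid` and by labels. -/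
def regQuot (X : WTS Lab) (hX : isRegular Lab X) : WTS Lab where
  State := Quotient (stateSetoid X)
  Act := Set.range X.lab
  lab := Subtype.val
  Tr := RegTr X
  ne_nil := by
    rintro _ _ _ ⟨_, _, _, h, _, rfl, _⟩
    simpa using X.ne_nil h
  multiset := by
    rintro _ _ _ l' hp ⟨α, l, β, h, rfl, rfl, rfl⟩
    obtain ⟨k, hk, rfl⟩ := perm_of_map_perm _ hp
    exact ⟨α, k, β, X.multiset hk h, rfl, rfl, rfl⟩
  composition := by
    intro _ _ ν₁ ν₂ a b c ha hb hc h1 h2 h3 h4 h5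
    have h1' := h1
    obtain ⟨α, l, β, h, rfl, hl, rfl⟩ := h1
    obtain ⟨ab, c, rfl, hab, rfl⟩ := List.map_eq_append_iff.1 hl
    obtain ⟨a, b, rfl, rfl, rfl⟩ := List.map_eq_append_iff.1 hab
    have ha' : a ≠ [] := by simpa using ha
    have hb' : b ≠ [] := by simpa using hb
    have hc' : c ≠ [] := by simpa using hc
    have h' := h
    rw [List.append_assoc] at h'
    obtain ⟨s, k2, k3⟩ := (hX.2 _ _ a (b ++ c) ha' (by simp [hc']) h').exists
    obtain ⟨t, k4, k5⟩ := (hX.2 _ _ (a ++ b) c (by simp [ha']) hc' h).exists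
    have e1 : Quotient.mk _ s = ν₁ := by
      refine RegTr.state_eq (by simpa using h1') ⟨_, _, _, k2, rfl, rfl, rfl⟩ ?_ h2 h3
      exact ⟨_, _, _, k3, rfl, by simp, rfl⟩
    have e2 : Quotient.mk _ t = ν₂ := by
      refine RegTr.state_eq h1' ?_ ⟨_, _, _, k5, rfl, rfl, rfl⟩ h4 h5
      exact ⟨_, _, _, k4, rfl, by simp, rfl⟩
    exact ⟨s, b, t, X.composition ha' hb' hc' h k2 k3 k4 k5, e1, rfl, e2⟩

theorem isRightAdjoint_sInjRTS : (sInjRTS Lab).ι.IsRightAdjoint := by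
  refine isRightAdjoint_of_reflections _ fun X => ?_
  have hQ : isRegular Lab (regQuot X.obj X.property) := by
    constructor
    · rintro ⟨_, u, rfl⟩
      obtain ⟨α, β, h⟩ := X.property.1 u
      exact ⟨Quotient.mk _ α, Quotient.mk _ β, α, _, β, h, rfl, rfl, rfl⟩
    · intro α β a b ha hb h
      have h0 := h
      obtain ⟨α, l, β, h, rfl, hl, rfl⟩ := h
      obtain ⟨a, b, rfl, rfl, rfl⟩ := List.map_eq_append_iff.1 hl
      have ha' : a ≠ [] := fun h => ha (h ▸ rfl)
      have hb' : b ≠ [] := fun h => hb (h ▸ rfl)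
      obtain ⟨ν, h1, h2⟩ := (X.property.2 _ _ a b ha' hb' h).exists
      have h1' : RegTr X.obj (Quotient.mk _ α) _ (Quotient.mk _ ν) :=
        ⟨_, _, _, h1, rfl, rfl, rfl⟩
      have h2' : RegTr X.obj (Quotient.mk _ ν) _ (Quotient.mk _ β) :=
        ⟨_, _, _, h2, rfl, rfl, rfl⟩
      exact ⟨Quotient.mk _ ν, ⟨h1', h2'⟩, fun ν' h' => RegTr.state_eq h0 h'.1 h'.2 h1' h2'⟩
  let η : X.obj ⟶ regQuot X.obj X.property := Hom.mk (Y := regQuot X.obj X.property)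
    (Quotient.mk _) (Set.rangeFactorization _) (fun _ => rfl)
    (fun h => ⟨_, _, _, h, rfl, rfl, rfl⟩)
  refine ⟨⟨_, hQ⟩, (sInjRTS_iff _).2 Subtype.val_injective, ObjectProperty.homMk η,
    fun Y hY f => ?_⟩
  rw [sInjRTS_iff] at hY
  let g : regQuot X.obj X.property ⟶ Y.obj := Hom.mk (X := regQuot X.obj X.property)
    (descState Y.property hY f.hom) (descAct f.hom) (lab_descAct f.hom)
    (fun h => RegTr.map Y.property hY f.hom h)
  refine ⟨ObjectProperty.homMk g, ?_, ?_⟩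
  · exact ObjectProperty.hom_ext _ (Hom.ext rfl (descAct_comp hY f.hom))
  · intro k hk
    refine ObjectProperty.hom_ext _ (Hom.ext (funext fun s => ?_) (funext fun r => hY ?_))
    · induction s using Quotient.inductionOn with | _ s =>
      exact congrFun (congrArg (fun k => k.hom.onState) hk) s
    · exact (k.hom.lab_onAct r).trans (lab_descAct f.hom r).symm

end WTS

/-! ### The reflections and their units -/

instance {Lab : Type u} : (sInjCTS Lab).ι.IsRightAdjoint := WTS.isRightAdjoint_sInjCTS

instance {Lab : Type u} : (sInjRTS Lab).ι.IsRightAdjoint := WTS.isRightAdjoint_sInjRTS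

/-- The reflection `L_S^CTS`, left adjoint of the inclusion of the full subcategory of `S`-injective
cubical transition systems. -/
noncomputable def reflCTS (Lab : Type u) : CTS Lab ⥤ (sInjCTS Lab).FullSubcategory :=
  (sInjCTS Lab).ι.leftAdjoint

/-- The reflection `L_S^RTS`, left adjoint of the inclusion of the full subcategory of `S`-injective
regular transition systems. -/
noncomputable def reflRTS (Lab : Type u) : RTS Lab ⥤ (sInjRTS Lab).FullSubcategory :=
  (sInjRTS Lab).ι.leftAdjoint

/-- The unit map `X ⟶ L_S^CTS(X)`, as a map of transition systems. -/
noncomputable def unitCTS {Lab : Type u} (X : CTS Lab) :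
    WTS.Hom X.obj ((reflCTS Lab).obj X).obj.obj :=
  ((Adjunction.ofIsRightAdjoint (sInjCTS Lab).ι).unit.app X).hom

/-- The unit map `Y ⟶ L_S^RTS(Y)`, as a map of transition systems. -/
noncomputable def unitRTS {Lab : Type u} (Y : RTS Lab) :
    WTS.Hom Y.obj ((reflRTS Lab).obj Y).obj.obj :=
  ((Adjunction.ofIsRightAdjoint (sInjRTS Lab).ι).unit.app Y).hom

/-- A map of transition systems is onto on transitions: every transition of the target is the image
of a transition of the source. -/
def WTS.Hom.OntoOnTransitions {Lab : Type u} {X Y : WTS Lab} (f : WTS.Hom X Y) : Prop :=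
  ∀ (α : Y.State) (l : List Y.Act) (β : Y.State), Y.Tr α l β →
    ∃ (α' : X.State) (l' : List X.Act) (β' : X.State),
      X.Tr α' l' β' ∧ f.onState α' = α ∧ l'.map f.onAct = l ∧ f.onState β' = β

/-!
A transition system is `S`-injective exactly when its labelling map is one-to-one, and `WTS.labQuot`
and `WTS.regQuot` are quotients of `X` through which every map from `X` to an `S`-injective object
(cubical, resp. regular) factors.  The unit `X ⟶ L X` therefore factors through the quotient map,
and by the universal property of the unit `L X` is a retract of the quotient
(`exists_retraction_of_factors`).  Surjectivity on states, actions and transitions thus passes from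
the quotient map to the unit, and so does injectivity on states, since the quotient map also factors
through the unit.  In the cubical case the quotient map is the identity on states; in the regular
case the transitions of the quotient are by definition the images of transitions.

The two negative statements are witnessed by systems with two states and two actions of the same
label.
* In `WTS.cubicalExample`, there is a `3`-transition in the action `true`, whereas all the smaller
  transitions required by the Composition axiom, with both intermediate states equal to `false`, are
  in the action `false`.  Identifying the actions makes the axiom applicable; it forces a loop at
  `false`, which is the image of no transition.
* In `WTS.regularExample`, the two actions give two `2`-transitions from `true` to `true`, one
  passing through `true` and the other through `false`.  Identifying the actions makes the two
  `2`-transitions equal, so uniqueness of the intermediate state identifies `true` and `false`.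
-/

/-- If every map from `X` to an object satisfying `P` factors through `η : X ⟶ Z`, where `Z`
satisfies `P`, then the reflection of `X` is a retract of `Z`, compatibly with the maps from
`X`. -/
theorem exists_retraction_of_factors {C : Type*} [Category C] (P : ObjectProperty C)
    [P.ι.IsRightAdjoint] {X Z : C} (hZ : P Z) (η : X ⟶ Z)
    (hη : ∀ Y, P Y → ∀ f : X ⟶ Y, ∃ g : Z ⟶ Y, η ≫ g = f) :
    ∃ (g : (P.ι.leftAdjoint.obj X).obj ⟶ Z) (h : Z ⟶ (P.ι.leftAdjoint.obj X).obj),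
      (Adjunction.ofIsRightAdjoint P.ι).unit.app X ≫ g = η ∧
      η ≫ h = (Adjunction.ofIsRightAdjoint P.ι).unit.app X ∧ g ≫ h = 𝟙 _ := by
  let adj := Adjunction.ofIsRightAdjoint P.ι
  obtain ⟨h, hh⟩ := hη _ (P.ι.leftAdjoint.obj X).property (adj.unit.app X)
  let g := (adj.homEquiv X ⟨Z, hZ⟩).symm η
  have hg : adj.unit.app X ≫ g.hom = η := by
    have := (adj.homEquiv X ⟨Z, hZ⟩).apply_symm_apply η
    rwa [adj.homEquiv_unit] at this
  refine ⟨g.hom, h, hg, hh, ?_⟩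
  let k : P.ι.leftAdjoint.obj X ⟶ P.ι.leftAdjoint.obj X := ObjectProperty.homMk (g.hom ≫ h)
  have hk : k = 𝟙 _ := by
    apply (adj.homEquiv X _).injective
    rw [adj.homEquiv_unit, adj.homEquiv_unit]
    change adj.unit.app X ≫ g.hom ≫ h = adj.unit.app X ≫ 𝟙 _
    rw [Category.comp_id, ← Category.assoc, hg, hh]
  exact congrArg (fun k => k.hom) hk

namespace WTS

variable {Lab : Type u}

/-! ### The unit as a retract of the quotient map -/

theorem labQuot_isCubical {X : WTS Lab} (hX : isCubical Lab X) :
    isCubical Lab (labQuot X) := by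
  refine ⟨?_, fun α β a b ha hb h => LabTr.intermediate hX.2 h ha hb rfl⟩
  rintro ⟨_, u, rfl⟩
  obtain ⟨α, β, h⟩ := hX.1 u
  exact ⟨α, β, .base h⟩

/-- The quotient map `X ⟶ labQuot X`, the identity on states. -/
def toLabQuot (X : WTS Lab) : X ⟶ labQuot X :=
  Hom.mk (Y := labQuot X) id (Set.rangeFactorization _) (fun _ => rfl) .base

theorem toLabQuot_factors {X Y : WTS Lab} (hY : Function.Injective Y.lab) (f : X ⟶ Y) :
    ∃ g : labQuot X ⟶ Y, toLabQuot X ≫ g = f :=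
  ⟨Hom.mk (X := labQuot X) f.onState (descAct f) (lab_descAct f) (fun h => LabTr.map hY f h),
    Hom.ext rfl (descAct_comp hY f)⟩

theorem regQuot_isRegular {X : WTS Lab} (hX : isRegular Lab X) :
    isRegular Lab (regQuot X hX) := by
  constructor
  · rintro ⟨_, u, rfl⟩
    obtain ⟨α, β, h⟩ := hX.1 u
    exact ⟨Quotient.mk _ α, Quotient.mk _ β, α, _, β, h, rfl, rfl, rfl⟩
  · intro α β a b ha hb h
    have h0 := h
    obtain ⟨α, l, β, h, rfl, hl, rfl⟩ := h
    obtain ⟨a, b, rfl, rfl, rfl⟩ := List.map_eq_append_iff.1 hl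
    have ha' : a ≠ [] := fun h => ha (h ▸ rfl)
    have hb' : b ≠ [] := fun h => hb (h ▸ rfl)
    obtain ⟨ν, h1, h2⟩ := (hX.2 _ _ a b ha' hb' h).exists
    have h1' : RegTr X (Quotient.mk _ α) _ (Quotient.mk _ ν) := ⟨_, _, _, h1, rfl, rfl, rfl⟩
    have h2' : RegTr X (Quotient.mk _ ν) _ (Quotient.mk _ β) := ⟨_, _, _, h2, rfl, rfl, rfl⟩
    exact ⟨Quotient.mk _ ν, ⟨h1', h2'⟩, fun ν' h' => RegTr.state_eq h0 h'.1 h'.2 h1' h2'⟩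

/-- The quotient map `X ⟶ regQuot X hX`. -/
def toRegQuot (X : WTS Lab) (hX : isRegular Lab X) : X ⟶ regQuot X hX :=
  Hom.mk (Y := regQuot X hX) (Quotient.mk _) (Set.rangeFactorization _) (fun _ => rfl)
    (fun h => ⟨_, _, _, h, rfl, rfl, rfl⟩)

theorem toRegQuot_factors {X Y : WTS Lab} (hX : isRegular Lab X) (hY : isRegular Lab Y)
    (hl : Function.Injective Y.lab) (f : X ⟶ Y) :
    ∃ g : regQuot X hX ⟶ Y, toRegQuot X hX ≫ g = f :=
  ⟨Hom.mk (X := regQuot X hX) (descState hY hl f) (descAct f) (lab_descAct f)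
    (fun h => RegTr.map hY hl f h), Hom.ext rfl (descAct_comp hl f)⟩

theorem exists_retraction_unitCTS (X : CTS Lab) :
    ∃ (g : ((reflCTS Lab).obj X).obj.obj ⟶ labQuot X.obj)
      (h : labQuot X.obj ⟶ ((reflCTS Lab).obj X).obj.obj),
      unitCTS X ≫ g = toLabQuot X.obj ∧ toLabQuot X.obj ≫ h = unitCTS X ∧ g ≫ h = 𝟙 _ := by
  obtain ⟨g, h, h1, h2, h3⟩ := exists_retraction_of_factors (sInjCTS Lab) (X := X)
    (Z := ⟨labQuot X.obj, labQuot_isCubical X.property⟩)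
    ((sInjCTS_iff _).2 Subtype.val_injective) (ObjectProperty.homMk (toLabQuot X.obj))
    fun Y hY f => by
      obtain ⟨g, hg⟩ := toLabQuot_factors ((sInjCTS_iff _).1 hY) f.hom
      exact ⟨ObjectProperty.homMk g, ObjectProperty.hom_ext _ hg⟩
  exact ⟨g.hom, h.hom, congrArg (fun k => k.hom) h1, congrArg (fun k => k.hom) h2,
    congrArg (fun k => k.hom) h3⟩

theorem exists_retraction_unitRTS (X : RTS Lab) :
    ∃ (g : ((reflRTS Lab).obj X).obj.obj ⟶ regQuot X.obj X.property)
      (h : regQuot X.obj X.property ⟶ ((reflRTS Lab).obj X).obj.obj),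
      toRegQuot X.obj X.property ≫ h = unitRTS X ∧ g ≫ h = 𝟙 _ := by
  obtain ⟨g, h, -, h2, h3⟩ := exists_retraction_of_factors (sInjRTS Lab) (X := X)
    (Z := ⟨regQuot X.obj X.property, regQuot_isRegular X.property⟩)
    ((sInjRTS_iff _).2 Subtype.val_injective)
    (ObjectProperty.homMk (toRegQuot X.obj X.property))
    fun Y hY f => by
      obtain ⟨g, hg⟩ := toRegQuot_factors X.property Y.property ((sInjRTS_iff _).1 hY) f.hom
      exact ⟨ObjectProperty.homMk g, ObjectProperty.hom_ext _ hg⟩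
  exact ⟨g.hom, h.hom, congrArg (fun k => k.hom) h2, congrArg (fun k => k.hom) h3⟩

theorem onState_surjective_of_retraction {Q Z : WTS Lab} {g : Z ⟶ Q} {h : Q ⟶ Z}
    (hgh : g ≫ h = 𝟙 _) : Function.Surjective h.onState :=
  fun s => ⟨g.onState s, congrFun (congrArg Hom.onState hgh) s⟩

theorem onAct_surjective_of_retraction {Q Z : WTS Lab} {g : Z ⟶ Q} {h : Q ⟶ Z}
    (hgh : g ≫ h = 𝟙 _) : Function.Surjective h.onAct :=
  fun s => ⟨g.onAct s, congrFun (congrArg Hom.onAct hgh) s⟩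

theorem ontoOnTransitions_of_retraction {Q Z : WTS Lab} {g : Z ⟶ Q} {h : Q ⟶ Z}
    (hgh : g ≫ h = 𝟙 _) : Hom.OntoOnTransitions h := by
  have hs (s) : h.onState (g.onState s) = s := congrFun (congrArg Hom.onState hgh) s
  have ha : h.onAct ∘ g.onAct = id := congrArg Hom.onAct hgh
  exact fun α l β ht => ⟨_, _, _, g.map_tr ht, hs α, by rw [List.map_map, ha, List.map_id], hs β⟩

theorem Hom.OntoOnTransitions.comp {X Y Z : WTS Lab} {f : X ⟶ Y} {g : Y ⟶ Z}
    (hf : Hom.OntoOnTransitions f) (hg : Hom.OntoOnTransitions g) :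
    Hom.OntoOnTransitions (f ≫ g) := by
  intro α l β ht
  obtain ⟨α₁, l₁, β₁, ht₁, rfl, rfl, rfl⟩ := hg α l β ht
  obtain ⟨α₂, l₂, β₂, ht₂, rfl, rfl, rfl⟩ := hf α₁ l₁ β₁ ht₁
  exact ⟨α₂, l₂, β₂, ht₂, rfl, (List.map_map (g := g.onAct) (f := f.onAct) (l := l₂)).symm, rfl⟩

theorem unitCTS_onState_bijective (X : CTS Lab) : Function.Bijective (unitCTS X).onState := by
  obtain ⟨g, h, h1, h2, h3⟩ := exists_retraction_unitCTS X
  constructor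
  · have h1' : g.onState ∘ (unitCTS X).onState = id := congrArg Hom.onState h1
    exact Function.Injective.of_comp (f := g.onState) (h1' ▸ Function.injective_id)
  · rw [← h2]
    exact (onState_surjective_of_retraction h3).comp Function.surjective_id

theorem unitCTS_onAct_surjective (X : CTS Lab) : Function.Surjective (unitCTS X).onAct := by
  obtain ⟨g, h, -, h2, h3⟩ := exists_retraction_unitCTS X
  rw [← h2]
  exact (onAct_surjective_of_retraction h3).comp Set.rangeFactorization_surjective

theorem unitRTS_onState_surjective (Y : RTS Lab) : Function.Surjective (unitRTS Y).onState := by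
  obtain ⟨g, h, h2, h3⟩ := exists_retraction_unitRTS Y
  rw [← h2]
  exact (onState_surjective_of_retraction h3).comp Quotient.mk_surjective

theorem unitRTS_onAct_surjective (Y : RTS Lab) : Function.Surjective (unitRTS Y).onAct := by
  obtain ⟨g, h, h2, h3⟩ := exists_retraction_unitRTS Y
  rw [← h2]
  exact (onAct_surjective_of_retraction h3).comp Set.rangeFactorization_surjective

theorem unitRTS_ontoOnTransitions (Y : RTS Lab) : (unitRTS Y).OntoOnTransitions := by
  obtain ⟨g, h, h2, h3⟩ := exists_retraction_unitRTS Y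
  rw [← h2]
  exact Hom.OntoOnTransitions.comp (fun _ _ _ ht => ht) (ontoOnTransitions_of_retraction h3)

/-! ### A cubical transition system with a missing transition -/

/-- Two states and two actions, all labels being `x`.  The nonempty words in the action `true`
are transitions from the state `true` to itself.  The words of length `1` or `2` in the action `false`
are transitions between any two states which are not both `false`. -/
def cubicalExample (x : Lab) : WTS Lab where
  State := ULift.{u} Bool
  Act := ULift.{u} Bool
  lab _ := x
  Tr s l t := l ≠ [] ∧ (((∀ u ∈ l, u = ⟨true⟩) ∧ s = ⟨true⟩ ∧ t = ⟨true⟩) ∨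
    ((∀ u ∈ l, u = ⟨false⟩) ∧ l.length ≤ 2 ∧ (s = ⟨true⟩ ∨ t = ⟨true⟩)))
  ne_nil h := h.1
  multiset hp h := by
    simp only [← hp.mem_iff, ← hp.length_eq]
    exact ⟨fun h' => h.1 (List.Perm.eq_nil (h' ▸ hp)), h.2⟩
  composition := by
    rintro s t ν₁ ν₂ a b c ha hb hc ⟨-, h⟩ ⟨-, h2⟩ - - ⟨-, h5⟩
    refine ⟨hb, ?_⟩
    have la := List.length_pos_iff.2 ha
    have lb := List.length_pos_iff.2 hb
    have lc := List.length_pos_iff.2 hc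
    obtain ⟨u, hu⟩ := List.exists_mem_of_ne_nil a ha
    obtain ⟨v, hv⟩ := List.exists_mem_of_ne_nil c hc
    simp only [List.length_append, List.mem_append] at h
    -- The composed word has length at least `3`, hence consists of the action `true`.
    rcases h with ⟨h, -⟩ | ⟨-, h, -⟩
    · left
      refine ⟨fun w hw => h w (by simp [hw]), ?_, ?_⟩
      · rcases h2 with h2 | h2
        · exact h2.2.2
        · cases (h u (by simp [hu])).symm.trans (h2.1 u hu)
      · rcases h5 with h5 | h5
        · exact h5.2.1
        · cases (h v (by simp [hv])).symm.trans (h5.1 v hv)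
    · omega

theorem cubicalExample_isCubical (x : Lab) : isCubical Lab (cubicalExample x) := by
  constructor
  · rintro ⟨_ | _⟩
    · exact ⟨⟨true⟩, ⟨true⟩, by simp [cubicalExample]⟩
    · exact ⟨⟨true⟩, ⟨true⟩, by simp [cubicalExample]⟩
  · intro s t (a : List (ULift.{u} Bool)) (b : List (ULift.{u} Bool)) ha hb ⟨_, h⟩
    change ((∀ u ∈ a ++ b, u = _) ∧ _) ∨ ((∀ u ∈ a ++ b, u = _) ∧ (a ++ b).length ≤ 2 ∧ _) at h
    simp only [List.length_append, List.mem_append] at h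
    have la := List.length_pos_iff.2 ha
    have lb := List.length_pos_iff.2 hb
    refine ⟨⟨true⟩, ⟨ha, ?_⟩, ⟨hb, ?_⟩⟩
    · rcases h with ⟨h, h1, h2⟩ | ⟨h, h1, h2⟩
      · exact .inl ⟨fun w hw => h w (.inl hw), h1, rfl⟩
      · exact .inr ⟨fun w hw => h w (.inl hw), by omega, .inr rfl⟩
    · rcases h with ⟨h, h1, h2⟩ | ⟨h, h1, h2⟩
      · exact .inl ⟨fun w hw => h w (.inr hw), rfl, h2⟩
      · exact .inr ⟨fun w hw => h w (.inr hw), by omega, .inl rfl⟩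

/-- The Composition axiom in `Z`, applied to the image of `(true, [true, true, true], true)`, with
both intermediate states the image of `false`: the four smaller transitions are images of
transitions in the action `false`. -/
theorem tr_false_false_of_cubicalExample {x : Lab} {Z : WTS Lab}
    (hZ : Function.Injective Z.lab) (f : cubicalExample x ⟶ Z) :
    Z.Tr (f.onState (⟨false⟩ : ULift Bool)) [f.onAct (⟨false⟩ : ULift Bool)]
      (f.onState (⟨false⟩ : ULift Bool)) := by
  have e : f.onAct (⟨true⟩ : ULift Bool) = f.onAct (⟨false⟩ : ULift Bool) :=
    hZ ((f.lab_onAct (⟨true⟩ : ULift Bool)).trans (f.lab_onAct (⟨false⟩ : ULift Bool)).symm)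
  have h1 := f.map_tr (α := (⟨true⟩ : ULift Bool)) (β := (⟨true⟩ : ULift Bool))
    (l := ([⟨true⟩, ⟨true⟩, ⟨true⟩] : List (ULift Bool))) (by simp [cubicalExample])
  have h2 := f.map_tr (α := (⟨true⟩ : ULift Bool)) (β := (⟨false⟩ : ULift Bool))
    (l := ([⟨false⟩] : List (ULift Bool))) (by simp [cubicalExample])
  have h3 := f.map_tr (α := (⟨false⟩ : ULift Bool)) (β := (⟨true⟩ : ULift Bool))
    (l := ([⟨false⟩, ⟨false⟩] : List (ULift Bool))) (by simp [cubicalExample])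
  have h4 := f.map_tr (α := (⟨true⟩ : ULift Bool)) (β := (⟨false⟩ : ULift Bool))
    (l := ([⟨false⟩, ⟨false⟩] : List (ULift Bool))) (by simp [cubicalExample])
  have h5 := f.map_tr (α := (⟨false⟩ : ULift Bool)) (β := (⟨true⟩ : ULift Bool))
    (l := ([⟨false⟩] : List (ULift Bool))) (by simp [cubicalExample])
  change Z.Tr _ [_, _, _] _ at h1
  rw [e] at h1
  exact Z.composition (a := [_]) (b := [_]) (c := [_]) (by simp) (by simp) (by simp) h1 h2 h3 h4 h5

theorem unitCTS_cubicalExample_not_ontoOnTransitions (x : Lab) :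
    ¬ (unitCTS ⟨cubicalExample x, cubicalExample_isCubical x⟩).OntoOnTransitions := by
  intro h
  set X : CTS Lab := ⟨cubicalExample x, cubicalExample_isCubical x⟩
  have hZ := (sInjCTS_iff _).1 ((reflCTS Lab).obj X).property
  obtain ⟨s, l, t, ht, hs, -, ht'⟩ := h _ _ _ (tr_false_false_of_cubicalExample hZ (unitCTS X))
  obtain rfl := (unitCTS_onState_bijective X).1 hs
  obtain rfl := (unitCTS_onState_bijective X).1 ht'
  rcases ht with ⟨-, ⟨-, h, -⟩ | ⟨-, -, h | h⟩⟩ <;> cases h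

/-! ### A regular transition system whose states get identified -/

/-- Two states and two actions, all labels being `x`.  The words of length `1` or `2` in the action
`true` are transitions from the state `true` to itself.  The action `false` exchanges the two
states, and `[false, false]` is a transition from the state `true` to itself (but there is none from
`false` to itself). -/
def regularExample (x : Lab) : WTS Lab where
  State := ULift.{u} Bool
  Act := ULift.{u} Bool
  lab _ := x
  Tr s l t := (l = [⟨true⟩] ∧ s = ⟨true⟩ ∧ t = ⟨true⟩) ∨
    (l = [⟨true⟩, ⟨true⟩] ∧ s = ⟨true⟩ ∧ t = ⟨true⟩) ∨
    (l = [⟨false⟩] ∧ s ≠ t) ∨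
    (l = [⟨false⟩, ⟨false⟩] ∧ s = ⟨true⟩ ∧ t = ⟨true⟩)
  ne_nil := by
    rintro _ _ _ (⟨rfl, -⟩ | ⟨rfl, -⟩ | ⟨rfl, -⟩ | ⟨rfl, -⟩) <;> simp
  multiset := by
    -- All transitions have constant words, which are not affected by permutations.
    have hrep {l : List (ULift Bool)} {n : ℕ} {u} (h : (List.replicate n u).Perm l) :
        l = List.replicate n u := List.perm_replicate.1 h.symm
    rintro _ _ _ l' hp (⟨rfl, h⟩ | ⟨rfl, h⟩ | ⟨rfl, h⟩ | ⟨rfl, h⟩)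
    · exact .inl ⟨hrep (n := 1) hp, h⟩
    · exact .inr (.inl ⟨hrep (n := 2) hp, h⟩)
    · exact .inr (.inr (.inl ⟨hrep (n := 1) hp, h⟩))
    · exact .inr (.inr (.inr ⟨hrep (n := 2) hp, h⟩))
  composition := by
    -- There are no transitions of length at least `3`.
    intro s t _ _ a b c ha hb hc h
    have la := List.length_pos_iff.2 ha
    have lb := List.length_pos_iff.2 hb
    have lc := List.length_pos_iff.2 hc
    rcases h with ⟨h, -⟩ | ⟨h, -⟩ | ⟨h, -⟩ | ⟨h, -⟩ <;>
    · have := congrArg List.length h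
      simp only [List.length_append, List.length_cons, List.length_nil] at this
      omega

theorem regularExample_isRegular (x : Lab) : isRegular Lab (regularExample x) := by
  constructor
  · rintro ⟨_ | _⟩
    · exact ⟨⟨true⟩, ⟨false⟩, by simp [regularExample]⟩
    · exact ⟨⟨true⟩, ⟨true⟩, by simp [regularExample]⟩
  · intro s t (a : List (ULift.{u} Bool)) (b : List (ULift.{u} Bool)) ha hb h
    have hsplit {u v : ULift.{u} Bool} (h : a ++ b = [u, v]) : a = [u] ∧ b = [v] := by
      rcases List.append_eq_cons_iff.1 h with ⟨h, -⟩ | ⟨a', rfl, h'⟩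
      · exact absurd h ha
      · rcases List.append_eq_singleton_iff.1 h'.symm with ⟨rfl, rfl⟩ | ⟨-, h''⟩
        · exact ⟨rfl, rfl⟩
        · exact absurd h'' hb
    have hone {u : ULift.{u} Bool} (h : a ++ b = [u]) : False := by
      rcases List.append_eq_singleton_iff.1 h with ⟨h, -⟩ | ⟨-, h⟩
      exacts [ha h, hb h]
    rcases h with ⟨h, -⟩ | ⟨h, rfl, rfl⟩ | ⟨h, -⟩ | ⟨h, rfl, rfl⟩
    · exact (hone h).elim
    · obtain ⟨rfl, rfl⟩ := hsplit h
      refine ⟨⟨true⟩, by simp [regularExample], ?_⟩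
      rintro ⟨_ | _⟩ <;> simp [regularExample]
    · exact (hone h).elim
    · obtain ⟨rfl, rfl⟩ := hsplit h
      refine ⟨⟨false⟩, by simp [regularExample], ?_⟩
      rintro ⟨_ | _⟩ <;> simp [regularExample]

theorem onState_eq_of_regularExample {x : Lab} {Z : WTS Lab} (hZ : isRegular Lab Z)
    (hl : Function.Injective Z.lab) (f : regularExample x ⟶ Z) :
    f.onState (⟨true⟩ : ULift Bool) = f.onState (⟨false⟩ : ULift Bool) := by
  have e : f.onAct (⟨true⟩ : ULift Bool) = f.onAct (⟨false⟩ : ULift Bool) :=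
    hl ((f.lab_onAct (⟨true⟩ : ULift Bool)).trans (f.lab_onAct (⟨false⟩ : ULift Bool)).symm)
  have h := f.map_tr (α := (⟨true⟩ : ULift Bool)) (β := (⟨true⟩ : ULift Bool))
    (l := ([⟨false⟩, ⟨false⟩] : List (ULift Bool))) (by simp [regularExample])
  have h1 := f.map_tr (α := (⟨true⟩ : ULift Bool)) (β := (⟨true⟩ : ULift Bool))
    (l := ([⟨true⟩] : List (ULift Bool))) (by simp [regularExample])
  have h2 := f.map_tr (α := (⟨true⟩ : ULift Bool)) (β := (⟨false⟩ : ULift Bool))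
    (l := ([⟨false⟩] : List (ULift Bool))) (by simp [regularExample])
  have h3 := f.map_tr (α := (⟨false⟩ : ULift Bool)) (β := (⟨true⟩ : ULift Bool))
    (l := ([⟨false⟩] : List (ULift Bool))) (by simp [regularExample])
  change Z.Tr _ [_] _ at h1
  rw [e] at h1
  exact (hZ.2 _ _ [_] [_] (by simp) (by simp) h).unique ⟨h1, h1⟩ ⟨h2, h3⟩

theorem unitRTS_regularExample_not_injective (x : Lab) :
    ¬ Function.Injective (unitRTS ⟨regularExample x, regularExample_isRegular x⟩).onState := by
  intro h
  set Y : RTS Lab := ⟨regularExample x, regularExample_isRegular x⟩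
  cases h (onState_eq_of_regularExample ((reflRTS Lab).obj Y).obj.property
    ((sInjRTS_iff _).1 ((reflRTS Lab).obj Y).property) (unitRTS Y))

end WTS

theorem mainTheorem11 (Lab : Type u) [Nonempty Lab] :
    (∀ X : CTS Lab, Function.Bijective (unitCTS X).onState ∧
      Function.Surjective (unitCTS X).onAct) ∧
    (∃ X₀ : CTS Lab, ¬ (unitCTS X₀).OntoOnTransitions) ∧
    (∀ Y : RTS Lab, Function.Surjective (unitRTS Y).onState ∧
      Function.Surjective (unitRTS Y).onAct ∧ (unitRTS Y).OntoOnTransitions) ∧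
    (∃ Y₀ : RTS Lab, ¬ Function.Bijective (unitRTS Y₀).onState) := by
  obtain ⟨x⟩ := ‹Nonempty Lab›
  exact ⟨fun X => ⟨WTS.unitCTS_onState_bijective X, WTS.unitCTS_onAct_surjective X⟩,
    ⟨_, WTS.unitCTS_cubicalExample_not_ontoOnTransitions x⟩,
    fun Y => ⟨WTS.unitRTS_onState_surjective Y, WTS.unitRTS_onAct_surjective Y,
      WTS.unitRTS_ontoOnTransitions Y⟩,
    ⟨_, fun h => WTS.unitRTS_regularExample_not_injective x h.1⟩⟩
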